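/- For $n\ge 1$ let $P_n\subset\mathbb{R}^n$ be the permutohedron, the convex hull of the points $(\sigma^{-1}(1),\dots,\sigma^{-1}(n))$, $\sigma\in S_n$, and let $\Delta^k=v_1\cdots v_{k+1}$ be the standard $k$-simplex. Let $k\ge 2$, $m_1,\dots,m_k\ge 1$, $\epsilon>0$ and $I=[0,1]$. Put $$B=P_{m_1}\times\cdots\times P_{m_k}\times\Delta^k,\qquad G=P_{m_1}\times\cdots\times P_{m_k}\times\bigcup_{i=2}^{k}v_1\cdots\widehat{v_i}\cdots v_{k+1},$$ where $v_1\cdots\widehat{v_i}\cdots v_{k+1}$ is the facet of $\Delta^k$ opposite to $v_i$. Let $\partial B$ be the boundary of the convex polytope $B$ in its affine span (which has dimension $d=m_1+\cdots+m_k$), let $\mathrm{Int}(G)$ be the interior of $G$ in $\partial B$, and put $U=\partial B\setminus\mathrm{Int}(G)$. Let $E=\mathrm{Ext}_\epsilon(B)$ be the space obtained from the basic cell $B$ and the tab $G\times[0,\epsilon]$ by identifying $x\in G\subset B$ with $(x,0)$. Let $\partial E$ be the boundary of the $d$-dimensional topological manifold with boundary $E$, that is, the set of points of $E$ that have no open neighbourhood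 homeomorphic to an open subset of $\mathbb{R}^d$. Then there is a continuous map $H:E\times I\to E$ with $H(\cdot,0)=\mathrm{id}_E$ such that: 1. $H$ restricts to a deformation retraction of $B$ onto $U$: $H(B\times I)\subset B$, $H(B\times\{1\})=U$, and $H(x,t)=x$ for all $x\in U$, $t\in I$; 2. $H(\cdot,1)$ maps the tab $G\times[0,\epsilon]$ homeomorphically onto $E$; 3. $H(x,t)=x$ for all $x\in\partial E$, $t\in I$. -/

import Mathlib

/-- The vertex `v_σ = (σ⁻¹(1), …, σ⁻¹(n))` of the permutohedron. Indices and values in `Fin n` start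
at `0`, hence the `+ 1`. -/
def permVertex {n : ℕ} (σ : Equiv.Perm (Fin n)) : Fin n → ℝ :=
  fun i => ((σ⁻¹ i : Fin n) : ℕ) + 1

/-- The permutohedron `P_n ⊆ ℝⁿ`, the convex hull of the points `v_σ`, `σ ∈ S_n`. -/
def permutohedron (n : ℕ) : Set (Fin n → ℝ) :=
  convexHull ℝ (Set.range (permVertex (n := n)))

/-- The space `ℝ^{m_1} × ⋯ × ℝ^{m_k} × ℝ^{k+1}` that contains `P_{m_1} × ⋯ × P_{m_k} × Δ^k`. -/
abbrev CellSpace {k : ℕ} (m : Fin k → ℕ) : Type :=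
  ((i : Fin k) → (Fin (m i) → ℝ)) × (Fin (k + 1) → ℝ)

/-- The product `P_{m_1} × ⋯ × P_{m_k}`. -/
def permProduct {k : ℕ} (m : Fin k → ℕ) : Set ((i : Fin k) → (Fin (m i) → ℝ)) :=
  Set.univ.pi fun i => permutohedron (m i)

/-- The basic cell `P_{m_1} × ⋯ × P_{m_k} × Δ^k`. -/
def cell {k : ℕ} (m : Fin k → ℕ) : Set (CellSpace m) :=
  permProduct m ×ˢ stdSimplex ℝ (Fin (k + 1))

/-- The facet of `Δ^k` opposite to its vertex number `i` (numbered from `0`). -/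
def simplexFacet (k : ℕ) (i : Fin (k + 1)) : Set (Fin (k + 1) → ℝ) :=
  {x ∈ stdSimplex ℝ (Fin (k + 1)) | x i = 0}

/-- The glued part `P_{m_1} × ⋯ × P_{m_k} × ⋃_{i=2}^{k} v_1 ⋯ v̂_i ⋯ v_{k+1}` of the boundary of the
cell: the facets opposite to all the vertices except the first and the last one. -/
def gluedPart {k : ℕ} (m : Fin k → ℕ) : Set (CellSpace m) :=
  permProduct m ×ˢ ⋃ i ∈ {i : Fin (k + 1) | i ≠ 0 ∧ i ≠ Fin.last k}, simplexFacet k i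

/-- The boundary of the cell, that is, its frontier in its affine span
(a space of dimension `m_1 + ⋯ + m_k`). -/
def cellBoundary {k : ℕ} (m : Fin k → ℕ) : Set (CellSpace m) :=
  intrinsicFrontier ℝ (cell m)

/-- The interior of `A` relative to the subspace `Y`. -/
def interiorIn {X : Type*} [TopologicalSpace X] (Y A : Set X) : Set X :=
  (Subtype.val : Y → X) '' interior ((Subtype.val : Y → X) ⁻¹' A)

/-- The unglued part of the boundary of the cell: the boundary without the interior of the glued
part, the latter taken in the boundary. -/
def ungluedPart {k : ℕ} (m : Fin k → ℕ) : Set (CellSpace m) :=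
  cellBoundary m \ interiorIn (cellBoundary m) (gluedPart m)

/-- The extended cell `Ext_ε`: the union of the cell and of `gluedPart × [0, ε]` along
`gluedPart = gluedPart × {0}`. The cell is placed at height `0` of `CellSpace m × ℝ`, so that
the two pieces, both compact, meet exactly in `gluedPart × {0}`. -/
def extCell {k : ℕ} (m : Fin k → ℕ) (ε : ℝ) : Set (CellSpace m × ℝ) :=
  cell m ×ˢ {0} ∪ gluedPart m ×ˢ Set.Icc 0 ε

/-- The basic cell, as a subset of the extended cell. -/
def basicInExt {k : ℕ} (m : Fin k → ℕ) (ε : ℝ) : Set (extCell m ε) :=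
  {z | z.1 ∈ cell m ×ˢ ({0} : Set ℝ)}

/-- The unglued part of the boundary of the basic cell, as a subset of the extended cell. -/
def ungluedInExt {k : ℕ} (m : Fin k → ℕ) (ε : ℝ) : Set (extCell m ε) :=
  {z | z.1 ∈ ungluedPart m ×ˢ ({0} : Set ℝ)}

/-- The tab `gluedPart × [0, ε]`, as a subset of the extended cell. -/
def tabInExt {k : ℕ} (m : Fin k → ℕ) (ε : ℝ) : Set (extCell m ε) :=
  {z | z.1 ∈ gluedPart m ×ˢ Set.Icc (0 : ℝ) ε}

/-- The boundary of a topological manifold `X` of dimension `d` with boundary: the points that have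
no open neighbourhood homeomorphic to an open subset of `ℝ^d`. -/
def manifoldBoundary (d : ℕ) (X : Type*) [TopologicalSpace X] : Set X :=
  {x | ¬ ∃ e : OpenPartialHomeomorph X (EuclideanSpace ℝ (Fin d)), x ∈ e.source}

/-!
Look at the cell `B` from a point of its affine span that lies beyond the glued facets and beyond
no others. Every ray from that point that meets `B` enters it through `G` and leaves it through `U`.
Prolonging the rays by the tab, the extended cell becomes the region `{(x, s) | 0 ≤ s ≤ h x}` below
the graph of a continuous function `h ≥ ε` on `G`, where the tab is the part `s ≤ ε`, the cell is
the part `s ≥ ε` and `U` is the graph of `h`. The homotopy moves the points along the segments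
`{x} × [0, h x]`: it stretches `[0, ε]` linearly over `[0, h x]` and pushes `[ε, h x]` to the top.
It moves no point of the bottom, of the top, or of the fibres over the rim `h = ε`, and the rest of
the region is open and embeds openly in `ℝ^d`, so it contains no point of the manifold boundary.

In coordinates centred at the viewpoint, `B` is `{v | 1 ≤ lo v, hi v ≤ 1}` with `lo` and `hi`
positively homogeneous: the barycentric coordinates of index `2, …, k` are `-1` at the viewpoint, so
`lo` is the minimum of the corresponding coordinates of `v`, and `hi` is the gauge of the convex set
cut out by the other facets.
-/

/-- The property of the homotopy `H` of the theorem, for an arbitrary space `E`: it retracts `B`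
onto `U` inside `B`, its end maps `T` homeomorphically onto `E`, and it fixes `M` pointwise. -/
def HasTabStretching {E : Type*} [TopologicalSpace E] (B U T M : Set E) : Prop :=
  ∃ (f : C(E, E)) (H : ContinuousMap.Homotopy (ContinuousMap.id E) f),
    ((∀ t : unitInterval, ∀ x ∈ B, H (t, x) ∈ B) ∧
      (fun x => H (1, x)) '' B = U ∧
      (∀ t : unitInterval, ∀ x ∈ U, H (t, x) = x)) ∧
    (∃ e : T ≃ₜ E, ∀ x : T, e x = H (1, (x : E))) ∧
    (∀ t : unitInterval, ∀ x ∈ M, H (t, x) = x)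

namespace HasTabStretching

theorem mono_fixed {E : Type*} [TopologicalSpace E] {B U T M M' : Set E}
    (h : HasTabStretching B U T M) (hM : M' ⊆ M) : HasTabStretching B U T M' :=
  let ⟨f, H, hB, hT, hfix⟩ := h
  ⟨f, H, hB, hT, fun t x hx => hfix t x (hM hx)⟩

theorem preimage {E F : Type*} [TopologicalSpace E] [TopologicalSpace F] {B U T M : Set F}
    (h : HasTabStretching B U T M) (φ : E ≃ₜ F) :
    HasTabStretching (φ ⁻¹' B) (φ ⁻¹' U) (φ ⁻¹' T) (φ ⁻¹' M) := by
  obtain ⟨f, H, ⟨hB, hBU, hU⟩, ⟨e, he⟩, hM⟩ := h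
  let H' : C(unitInterval × E, E) := ⟨fun p => φ.symm (H (p.1, φ p.2)), by fun_prop⟩
  have fixed {t : unitInterval} {x : E} (hx : H (t, φ x) = φ x) : H' (t, x) = x := by
    simp [H', hx]
  refine ⟨⟨fun x => H' (1, x), by fun_prop⟩, ⟨H', fun x => fixed (H.map_zero_left _), fun _ => rfl⟩,
    ⟨fun t x hx => ?_, ?_, fun t x hx => fixed (hU t _ hx)⟩,
    ⟨((φ.sets rfl).trans e).trans φ.symm, fun x => congrArg φ.symm (he (φ.sets rfl x))⟩,
    fun t x hx => fixed (hM t _ hx)⟩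
  · change φ (φ.symm (H (t, φ x))) ∈ B
    rw [φ.apply_symm_apply]
    exact hB t _ hx
  · calc (fun x => φ.symm (H (1, φ x))) '' (φ ⁻¹' B)
        = φ.symm '' ((fun y => H (1, y)) '' (φ '' (φ ⁻¹' B))) := by simp only [Set.image_image]
      _ = φ ⁻¹' U := by rw [φ.image_preimage, hBU, φ.image_symm]

end HasTabStretching

/-- The region between the zero section of `X × ℝ` and the graph of `h`. -/
def subgraph {X : Type*} (h : X → ℝ) : Set (X × ℝ) := {p | p.2 ∈ Set.Icc 0 (h p.1)}

namespace subgraph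

variable {X : Type*} {h : X → ℝ} {ε : ℝ}

theorem mul_min_mem_Icc (hε : 0 < ε) (p : subgraph h) :
    h p.1.1 * min (p.1.2 / ε) 1 ∈ Set.Icc 0 (h p.1.1) :=
  have hh : 0 ≤ h p.1.1 := p.2.1.trans p.2.2
  ⟨mul_nonneg hh (le_min (div_nonneg p.2.1 hε.le) zero_le_one),
    mul_le_of_le_one_right hh (min_le_right _ _)⟩

/-- The deformation of a subgraph along its fibres that stretches the bottom segment `[0, ε]`
linearly over the whole fibre and pushes the rest of the fibre to its top. -/
noncomputable def slide (hε : 0 < ε) (t : unitInterval) (p : subgraph h) : subgraph h :=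
  ⟨(p.1.1, AffineMap.lineMap p.1.2 (h p.1.1 * min (p.1.2 / ε) 1) (t : ℝ)),
    (convex_Icc _ _).lineMap_mem p.2 (mul_min_mem_Icc hε p) t.2⟩

theorem slide_eq_self (hε : 0 < ε) (t : unitInterval) {p : subgraph h}
    (hp : h p.1.1 * min (p.1.2 / ε) 1 = p.1.2) : slide hε t p = p := by
  ext <;> simp [slide, hp]

theorem slide_zero (hε : 0 < ε) (p : subgraph h) : slide hε 0 p = p := by
  ext <;> simp [slide]

theorem slide_one_snd (hε : 0 < ε) (p : subgraph h) :
    (slide hε 1 p).1.2 = h p.1.1 * min (p.1.2 / ε) 1 := by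
  simp [slide]

theorem slide_one_snd_of_ge (hε : 0 < ε) {p : subgraph h} (hp : ε ≤ p.1.2) :
    (slide hε 1 p).1.2 = h p.1.1 := by
  rw [slide_one_snd, min_eq_right ((one_le_div hε).2 hp), mul_one]

theorem le_slide_snd (hε : 0 < ε) (t : unitInterval) {p : subgraph h} (hp : ε ≤ p.1.2) :
    ε ≤ (slide hε t p).1.2 := by
  refine (convex_Ici ε).lineMap_mem hp ?_ t.2
  rw [Set.mem_Ici, min_eq_right ((one_le_div hε).2 hp), mul_one]
  exact hp.trans p.2.2

theorem slide_eq_self_of_fixed (hε : 0 < ε) (hh : ∀ x, ε ≤ h x) (t : unitInterval)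
    {p : subgraph h} (hp : p.1.2 = 0 ∨ h p.1.1 = ε ∨ p.1.2 = h p.1.1) : slide hε t p = p := by
  refine slide_eq_self hε t ?_
  rcases hp with h0 | hhε | htop
  · simp [h0]
  · have hle : p.1.2 / ε ≤ 1 := (div_le_one hε).2 (p.2.2.trans_eq hhε)
    rw [min_eq_left hle, hhε, mul_div_cancel₀ _ hε.ne']
  · rw [htop, min_eq_right ((one_le_div hε).2 (hh _)), mul_one]

/-- The inverse of the end of `slide` on the bottom segments. -/
noncomputable def shrink (hε : 0 < ε) (hh : ∀ x, ε ≤ h x) (p : subgraph h) :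
    {p : subgraph h | p.1.2 ≤ ε} :=
  have hpos : 0 < h p.1.1 := hε.trans_le (hh _)
  have hle : ε * (p.1.2 / h p.1.1) ≤ ε :=
    mul_le_of_le_one_right hε.le ((div_le_one hpos).2 p.2.2)
  ⟨⟨(p.1.1, ε * (p.1.2 / h p.1.1)),
    mul_nonneg hε.le (div_nonneg p.2.1 hpos.le), hle.trans (hh _)⟩, hle⟩

variable [TopologicalSpace X]

theorem continuous_slide (hε : 0 < ε) (hcont : Continuous h) :
    Continuous fun q : unitInterval × subgraph h => slide hε q.1 q.2 := by
  simp only [slide, AffineMap.lineMap_apply_module']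
  fun_prop

theorem continuous_shrink (hε : 0 < ε) (hh : ∀ x, ε ≤ h x) (hcont : Continuous h) :
    Continuous (shrink hε hh) := by
  have hne (p : subgraph h) : h p.1.1 ≠ 0 := (hε.trans_le (hh _)).ne'
  have hheight : Continuous fun p : subgraph h => ε * (p.1.2 / h p.1.1) :=
    continuous_const.mul
      (continuous_subtype_val.snd.div (hcont.comp continuous_subtype_val.fst) hne)
  exact ((continuous_subtype_val.fst.prodMk hheight).subtype_mk _).subtype_mk _

/-- The end of `slide`, restricted to the bottom segments. -/
noncomputable def stretchHomeomorph (hε : 0 < ε) (hh : ∀ x, ε ≤ h x) (hcont : Continuous h) :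
    {p : subgraph h | p.1.2 ≤ ε} ≃ₜ subgraph h where
  toFun p := slide hε 1 p.1
  invFun := shrink hε hh
  left_inv := by
    rintro ⟨p, hp⟩
    have hpos : 0 < h p.1.1 := hε.trans_le (hh _)
    have hs : ε * (h p.1.1 * min (p.1.2 / ε) 1 / h p.1.1) = p.1.2 := by
      rw [min_eq_left ((div_le_one hε).2 hp)]
      field_simp
    ext <;> simp [shrink, slide, hs]
  right_inv p := by
    have hpos : 0 < h p.1.1 := hε.trans_le (hh _)
    have hs : h p.1.1 * min (ε * (p.1.2 / h p.1.1) / ε) 1 = p.1.2 := by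
      rw [mul_div_cancel_left₀ _ hε.ne', min_eq_left ((div_le_one hpos).2 p.2.2),
        mul_div_cancel₀ _ hpos.ne']
    ext <;> simp [shrink, slide, hs]
  continuous_toFun :=
    (continuous_slide hε hcont).comp (continuous_const.prodMk continuous_subtype_val)
  continuous_invFun := continuous_shrink hε hh hcont

theorem hasTabStretching (hε : 0 < ε) (hh : ∀ x, ε ≤ h x) (hcont : Continuous h) :
    HasTabStretching {p : subgraph h | ε ≤ p.1.2} {p | p.1.2 = h p.1.1} {p | p.1.2 ≤ ε}
      {p | p.1.2 = 0 ∨ h p.1.1 = ε ∨ p.1.2 = h p.1.1} := by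
  have hslide := continuous_slide hε hcont
  refine ⟨⟨fun p => slide hε 1 p, hslide.comp (continuous_const.prodMk continuous_id)⟩,
    ⟨⟨fun q => slide hε q.1 q.2, hslide⟩, slide_zero hε, fun _ => rfl⟩,
    ⟨fun t p hp => le_slide_snd hε t hp, subset_antisymm ?_ fun p hp => ?_,
      fun t p hp => slide_eq_self_of_fixed hε hh t (.inr (.inr hp))⟩,
    ⟨stretchHomeomorph hε hh hcont, fun _ => rfl⟩,
    fun t p hp => slide_eq_self_of_fixed hε hh t hp⟩
  · rintro _ ⟨p, hp, rfl⟩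
    exact slide_one_snd_of_ge hε hp
  · exact ⟨p, (hh _).trans_eq hp.symm, slide_eq_self_of_fixed hε hh 1 (.inr (.inr hp))⟩

end subgraph

section Topology

theorem mem_interiorIn_iff {X : Type*} [TopologicalSpace X] {Y A : Set X} {x : X} :
    x ∈ interiorIn Y A ↔ x ∈ Y ∧ A ∈ nhdsWithin x Y := by
  simp [interiorIn, mem_interior_iff_mem_nhds, preimage_coe_mem_nhds_subtype, and_comm]

theorem interiorIn_image {X Z : Type*} [TopologicalSpace X] [TopologicalSpace Z] {f : X → Z}
    (hf : Topology.IsEmbedding f) (Y A : Set X) :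
    interiorIn (f '' Y) (f '' A) = f '' interiorIn Y A := by
  have key (x : X) : f '' A ∈ nhdsWithin (f x) (f '' Y) ↔ A ∈ nhdsWithin x Y := by
    rw [← hf.map_nhdsWithin_eq, Filter.mem_map, Set.preimage_image_eq _ hf.injective]
  ext z
  constructor
  · intro hz
    obtain ⟨⟨x, hx, rfl⟩, h⟩ := mem_interiorIn_iff.1 hz
    exact ⟨x, mem_interiorIn_iff.2 ⟨hx, (key x).1 h⟩, rfl⟩
  · rintro ⟨x, hx, rfl⟩
    rw [mem_interiorIn_iff] at hx ⊢
    exact ⟨⟨x, hx.1, rfl⟩, (key x).2 hx.2⟩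

theorem intrinsicFrontier_eq_frontier {V : Type*} [NormedAddCommGroup V] [NormedSpace ℝ V]
    {s : Set V} (hs : (interior s).Nonempty) : intrinsicFrontier ℝ s = frontier s := by
  have hspan : affineSpan ℝ s = ⊤ := affineSpan_eq_top_of_nonempty_interior
    (hs.mono (interior_mono (subset_convexHull ℝ s)))
  have hopen : IsOpen (affineSpan ℝ s : Set V) := by simp [hspan]
  have hfrontier := hopen.isOpenMap_subtype_val.preimage_frontier_eq_frontier_preimage
    continuous_subtype_val s
  exact (congrArg _ hfrontier.symm).trans (Set.image_preimage_eq_of_subset (by simp [hspan]))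

theorem notMem_manifoldBoundary_of_isOpenEmbedding {d : ℕ} {X Y : Type*} [TopologicalSpace X]
    [TopologicalSpace Y] {j : Y → EuclideanSpace ℝ (Fin d)} (hj : Topology.IsOpenEmbedding j)
    {g : Y → X} (hg : Topology.IsOpenEmbedding g) (y : Y) : g y ∉ manifoldBoundary d X := by
  have : Nonempty Y := ⟨y⟩
  refine not_not_intro
    ⟨hg.toOpenPartialHomeomorph.symm.trans hj.toOpenPartialHomeomorph, ?_⟩
  simp

end Topology

/-- The union of `B`, placed at height `0`, and of the cylinder of height `ε` over `G`: for `G ⊆ B`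
it is `B` with a tab glued on along `G`. -/
def tabExtension {X : Type*} (B G : Set X) (ε : ℝ) : Set (X × ℝ) := B ×ˢ {0} ∪ G ×ˢ Set.Icc 0 ε

theorem image_tabExtension {Y Z : Type*} (f : Y → Z) (B G : Set Y) (ε : ℝ) :
    Prod.map f id '' tabExtension B G ε = tabExtension (f '' B) (f '' G) ε := by
  simp only [tabExtension, Set.image_union, Set.prodMap_image_prod, Set.image_id]

/-- A pair of positively homogeneous functions. A ray of points with `lo > 0` enters the region
`1 ≤ lo`, `hi ≤ 1` where `lo = 1` and leaves it where `hi = 1`. -/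
structure RadialPair (V : Type*) [NormedAddCommGroup V] [NormedSpace ℝ V] where
  lo : V → ℝ
  hi : V → ℝ
  continuous_lo : Continuous lo
  continuous_hi : Continuous hi
  lo_smul : ∀ (t : ℝ) (v : V), 0 < t → lo (t • v) = t * lo v
  hi_smul : ∀ (t : ℝ) (v : V), 0 < t → hi (t • v) = t * hi v
  hi_pos : ∀ v, 0 < lo v → 0 < hi v

namespace RadialPair

variable {V : Type*} [NormedAddCommGroup V] [NormedSpace ℝ V] (R : RadialPair V)

/-- The truncated cone cut out by the two functions. -/
def cone : Set V := {v | 1 ≤ R.lo v ∧ R.hi v ≤ 1}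

/-- The part of the truncated cone through which the rays enter. -/
def inlet : Set V := {v | R.lo v = 1 ∧ R.hi v ≤ 1}

/-- The part of the truncated cone through which the rays leave. -/
def outlet : Set V := {v | 1 ≤ R.lo v ∧ R.hi v = 1}

/-- The union of the rays that meet the truncated cone. -/
def rays : Set V := {v | 0 < R.lo v ∧ R.hi v ≤ R.lo v}

/-- The length of the ray through `x` in the truncated cone with a tab of height `ε`, measured by
`lo`: the ray leaves the cone at `(hi x)⁻¹ • x`, where `lo` is `(hi x)⁻¹`. -/
noncomputable def height (ε : ℝ) (x : R.inlet) : ℝ := (R.hi x)⁻¹ - 1 + ε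

/-- The point at which a ray enters the truncated cone. -/
noncomputable def foot (v : R.rays) : R.inlet :=
  ⟨(R.lo v)⁻¹ • (v : V), by
    have hv := inv_pos.2 v.2.1
    constructor
    · rw [R.lo_smul _ _ hv, inv_mul_cancel₀ v.2.1.ne']
    · rw [R.hi_smul _ _ hv]
      exact inv_mul_le_one_of_le₀ v.2.2 v.2.1.le⟩

section Rays

variable {R} {ε : ℝ}

theorem hi_inlet_pos (x : R.inlet) : 0 < R.hi x := R.hi_pos _ (by rw [x.2.1]; exact one_pos)

theorem le_height (x : R.inlet) : ε ≤ R.height ε x := by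
  have := (one_le_inv₀ (hi_inlet_pos x)).2 x.2.2
  simp only [height]
  linarith

theorem continuous_height : Continuous (R.height ε) :=
  (((R.continuous_hi.comp continuous_subtype_val).inv₀ fun x => (hi_inlet_pos x).ne').sub
    continuous_const).add continuous_const

theorem lo_smul_foot (v : R.rays) : R.lo v • (R.foot v : V) = v :=
  smul_inv_smul₀ v.2.1.ne' _

theorem foot_smul {a : ℝ} (ha : 0 < a) (x : R.inlet) (h : a • (x : V) ∈ R.rays) :
    R.foot ⟨a • x, h⟩ = x := by
  ext
  simp only [foot]
  rw [R.lo_smul _ _ ha, x.2.1, mul_one, inv_smul_smul₀ ha.ne']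

theorem height_foot (v : R.rays) : R.height ε (R.foot v) = R.lo v / R.hi v - 1 + ε := by
  simp only [height, foot]
  rw [R.hi_smul _ _ (inv_pos.2 v.2.1), mul_inv, inv_inv, div_eq_mul_inv]

theorem continuous_foot : Continuous R.foot :=
  (((R.continuous_lo.comp continuous_subtype_val).inv₀ fun v => v.2.1.ne').smul
    continuous_subtype_val).subtype_mk _

theorem cone_subset_rays : R.cone ⊆ R.rays := fun _ hv =>
  ⟨one_pos.trans_le hv.1, hv.2.trans hv.1⟩

theorem mem_tabExtension_iff (hε : 0 ≤ ε) {z : V × ℝ} :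
    z ∈ tabExtension R.cone R.inlet ε ↔
      z.1 ∈ R.cone ∧ z.2 ∈ Set.Icc 0 ε ∧ (z.2 = 0 ∨ R.lo z.1 = 1) := by
  constructor
  · rintro (⟨hv, hr⟩ | ⟨hv, hr⟩)
    · have hr : z.2 = 0 := hr
      exact ⟨hv, by simp [hr, hε], .inl hr⟩
    · exact ⟨⟨hv.1.ge, hv.2⟩, hr, .inr hv.1⟩
  · rintro ⟨hv, hr, h0 | h1⟩
    · exact .inl ⟨hv, h0⟩
    · exact .inr ⟨⟨h1, hv.2⟩, hr⟩

theorem smul_inlet_mem_cone {a : ℝ} (x : R.inlet) (h1 : 1 ≤ a) (h : a ≤ (R.hi x)⁻¹) :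
    a • (x : V) ∈ R.cone := by
  have ha := one_pos.trans_le h1
  refine ⟨?_, ?_⟩
  · rwa [R.lo_smul _ _ ha, x.2.1, mul_one]
  · rw [R.hi_smul _ _ ha]
    rwa [← le_div_iff₀ (hi_inlet_pos x), one_div]

end Rays

section Unfold

variable {R} {ε : ℝ}

/-- Straightening of the rays: a point of the truncated cone with a tab is sent to the foot of its
ray and its distance from the bottom of the ray. That distance is measured by `lo` in the cone, and
is at most `ε` in the tab and at least `ε` in the cone. -/
noncomputable def straighten (hε : 0 ≤ ε) (z : tabExtension R.cone R.inlet ε) :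
    subgraph (R.height ε) :=
  ⟨(R.foot ⟨z.1.1, cone_subset_rays ((mem_tabExtension_iff hε).1 z.2).1⟩,
    R.lo z.1.1 - 1 + ε - z.1.2), by
      obtain ⟨⟨h1, h2⟩, hr, -⟩ := (mem_tabExtension_iff hε).1 z.2
      have hpos := one_pos.trans_le h1
      have hdiv := le_div_self hpos.le (R.hi_pos _ hpos) h2
      refine ⟨?_, ?_⟩
      · linarith [hr.2]
      · rw [height_foot]
        linarith [hr.1]⟩

/-- The inverse of `straighten`. -/
noncomputable def unstraighten (hε : 0 ≤ ε) (p : subgraph (R.height ε)) :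
    tabExtension R.cone R.inlet ε :=
  ⟨((1 + max (p.1.2 - ε) 0) • (p.1.1 : V), max (ε - p.1.2) 0), by
    obtain ⟨⟨x, s⟩, hs0, hs⟩ := p
    simp only [height] at hs0 hs
    have := (one_le_inv₀ (hi_inlet_pos x)).2 x.2.2
    refine (mem_tabExtension_iff hε).2 ⟨smul_inlet_mem_cone x ?_ ?_, ⟨?_, ?_⟩, ?_⟩
    · exact le_add_of_nonneg_right (le_max_right _ _)
    · rw [← le_sub_iff_add_le']
      exact max_le (by linarith) (by linarith)
    · exact le_max_right _ _
    · exact max_le (by linarith) hε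
    · rcases le_total s ε with h | h
      · right
        rw [max_eq_right (sub_nonpos.2 h), add_zero, one_smul, x.2.1]
      · left
        exact max_eq_right (sub_nonpos.2 h)⟩

theorem unstraighten_straighten (hε : 0 ≤ ε) (z : tabExtension R.cone R.inlet ε) :
    unstraighten hε (straighten hε z) = z := by
  obtain ⟨⟨v, r⟩, hz⟩ := z
  obtain ⟨hv, hr, h⟩ := (mem_tabExtension_iff hε).1 hz
  have hlo : max (R.lo v - 1 + ε - r - ε) 0 = R.lo v - 1 := by
    rcases h with h | h <;> simp only at h
    · rw [h, max_eq_left] <;> linarith [hv.1]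
    · rw [h, max_eq_right] <;> linarith [hr.1]
  have hr' : max (ε - (R.lo v - 1 + ε - r)) 0 = r := by
    rcases h with h | h <;> simp only at h
    · rw [h, max_eq_right]; linarith [hv.1]
    · rw [h, max_eq_left] <;> linarith [hr.1]
  ext
  · simp only [unstraighten, straighten, hlo, add_sub_cancel]
    exact lo_smul_foot ⟨v, cone_subset_rays hv⟩
  · simp only [unstraighten, straighten, hr']

theorem straighten_unstraighten (hε : 0 ≤ ε) (p : subgraph (R.height ε)) :
    straighten hε (unstraighten hε p) = p := by
  obtain ⟨⟨x, s⟩, hs⟩ := p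
  have hpos : 0 < 1 + max (s - ε) 0 := add_pos_of_pos_of_nonneg one_pos (le_max_right _ _)
  have hs' : 1 + max (s - ε) 0 - 1 + ε - max (ε - s) 0 = s := by
    linarith [max_zero_sub_max_neg_zero_eq_self (s - ε), congrArg (max · 0) (neg_sub s ε)]
  ext1
  refine Prod.ext (foot_smul hpos x _) ?_
  simpa only [straighten, unstraighten, R.lo_smul _ _ hpos, x.2.1, mul_one] using hs'

theorem continuous_straighten (hε : 0 ≤ ε) : Continuous (straighten (R := R) hε) := by
  have hv : Continuous fun z : tabExtension R.cone R.inlet ε => z.1.1 := by fun_prop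
  exact ((continuous_foot.comp (hv.subtype_mk _)).prodMk
    ((((R.continuous_lo.comp hv).sub continuous_const).add continuous_const).sub
      continuous_subtype_val.snd)).subtype_mk _

/-- `straighten` as a homeomorphism. -/
noncomputable def straightenHomeomorph (hε : 0 ≤ ε) :
    tabExtension R.cone R.inlet ε ≃ₜ subgraph (R.height ε) where
  toFun := straighten hε
  invFun := unstraighten hε
  left_inv := unstraighten_straighten hε
  right_inv := straighten_unstraighten hε
  continuous_toFun := continuous_straighten hε
  continuous_invFun := by
    unfold unstraighten
    fun_prop

theorem le_straighten_snd_iff (hε : 0 ≤ ε) (z : tabExtension R.cone R.inlet ε) :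
    ε ≤ (straighten hε z).1.2 ↔ z.1 ∈ R.cone ×ˢ ({0} : Set ℝ) := by
  obtain ⟨hv, hr, h⟩ := (mem_tabExtension_iff hε).1 z.2
  simp only [straighten, Set.mem_prod, hv, true_and, Set.mem_singleton_iff]
  constructor
  · intro hle
    rcases h with h | h
    · exact h
    · linarith [hr.1]
  · intro h0
    linarith [hv.1]

theorem straighten_snd_le_iff (hε : 0 ≤ ε) (z : tabExtension R.cone R.inlet ε) :
    (straighten hε z).1.2 ≤ ε ↔ z.1 ∈ R.inlet ×ˢ Set.Icc 0 ε := by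
  obtain ⟨hv, hr, h⟩ := (mem_tabExtension_iff hε).1 z.2
  simp only [straighten, Set.mem_prod, hr, and_true]
  constructor
  · intro hle
    refine ⟨h.elim (fun h0 => le_antisymm ?_ hv.1) id, hv.2⟩
    linarith
  · intro hen
    linarith [hr.1, hen.1]

theorem straighten_snd_eq_height_iff (hε : 0 ≤ ε) (z : tabExtension R.cone R.inlet ε) :
    (straighten hε z).1.2 = R.height ε (straighten hε z).1.1 ↔
      z.1 ∈ R.outlet ×ˢ ({0} : Set ℝ) := by
  obtain ⟨hv, hr, -⟩ := (mem_tabExtension_iff hε).1 z.2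
  have hlo : 0 < R.lo z.1.1 := one_pos.trans_le hv.1
  have hhi : 0 < R.hi z.1.1 := R.hi_pos _ hlo
  simp only [straighten, height_foot, Set.mem_prod, Set.mem_singleton_iff]
  constructor
  · intro h
    have hle : R.lo z.1.1 / R.hi z.1.1 ≤ R.lo z.1.1 := by linarith [hr.1]
    have hone : R.hi z.1.1 = 1 :=
      le_antisymm hv.2 (by rwa [div_le_iff₀ hhi, le_mul_iff_one_le_right hlo] at hle)
    refine ⟨⟨hv.1, hone⟩, ?_⟩
    rw [hone] at h
    linarith
  · rintro ⟨⟨-, h1⟩, h0⟩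
    rw [h0, h1]
    ring

end Unfold

section Interior

variable {R} {ε : ℝ}

/-- The map that realises the subgraph of `height` inside `V`. -/
noncomputable def rise (p : subgraph (R.height ε)) : V := (1 + p.1.2) • (p.1.1 : V)

variable (R ε) in
/-- The points that `rise` reaches away from the bottom, the top and the rim of the subgraph. -/
def inner : Set V := {v | 1 < R.lo v ∧ R.hi v < R.lo v ∧ (R.lo v - ε) * R.hi v < R.lo v}

/-- The inverse of `rise`. -/
noncomputable def lower (w : R.inner ε) : subgraph (R.height ε) :=
  ⟨(R.foot ⟨w, one_pos.trans w.2.1, w.2.2.1.le⟩, R.lo w - 1), by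
    obtain ⟨w, h1, h2, h3⟩ := w
    have hdiv := (lt_div_iff₀ (R.hi_pos w (one_pos.trans h1))).2 h3
    refine ⟨sub_nonneg.2 h1.le, ?_⟩
    rw [height_foot]
    linarith⟩

theorem isOpen_inner : IsOpen (R.inner ε) :=
  (isOpen_lt continuous_const R.continuous_lo).inter
    ((isOpen_lt R.continuous_hi R.continuous_lo).inter
      (isOpen_lt ((R.continuous_lo.sub continuous_const).mul R.continuous_hi) R.continuous_lo))

theorem rise_lower (w : R.inner ε) : rise (lower w) = (w : V) := by
  simp only [rise, lower, add_sub_cancel]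
  exact lo_smul_foot (R := R) ⟨w, _⟩

theorem lo_rise (p : subgraph (R.height ε)) : R.lo (rise p) = 1 + p.1.2 := by
  rw [rise, R.lo_smul _ _ (by linarith [p.2.1]), p.1.1.2.1, mul_one]

theorem hi_rise (p : subgraph (R.height ε)) : R.hi (rise p) = (1 + p.1.2) * R.hi p.1.1 := by
  rw [rise, R.hi_smul _ _ (by linarith [p.2.1])]

theorem lower_rise (p : subgraph (R.height ε)) (hp : rise p ∈ R.inner ε) :
    lower ⟨rise p, hp⟩ = p := by
  ext1
  refine Prod.ext (foot_smul (by linarith [p.2.1]) _ _) ?_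
  simp only [lower, lo_rise, add_sub_cancel_left]

theorem isOpenEmbedding_lower : Topology.IsOpenEmbedding (lower (R := R) (ε := ε)) := by
  have hrise : Continuous (rise (R := R) (ε := ε)) := by
    unfold rise
    fun_prop
  have hlower : Continuous (lower (R := R) (ε := ε)) :=
    ((continuous_foot.comp (continuous_subtype_val.subtype_mk _)).prodMk
      ((R.continuous_lo.comp continuous_subtype_val).sub continuous_const)).subtype_mk _
  have hrange : Set.range (lower (R := R) (ε := ε)) = rise ⁻¹' R.inner ε := by
    refine subset_antisymm ?_ fun p hp => ⟨_, lower_rise p hp⟩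
    rintro _ ⟨w, rfl⟩
    rw [Set.mem_preimage, rise_lower]
    exact w.2
  refine ⟨.of_comp hlower hrise ?_, hrange ▸ isOpen_inner.preimage hrise⟩
  rw [show rise ∘ lower = (Subtype.val : R.inner ε → V) from funext rise_lower]
  exact .subtypeVal

theorem rise_mem_inner {p : subgraph (R.height ε)}
    (hp : ¬(p.1.2 = 0 ∨ R.height ε p.1.1 = ε ∨ p.1.2 = R.height ε p.1.1)) :
    rise p ∈ R.inner ε := by
  obtain ⟨⟨x, s⟩, hs0, hs⟩ := p
  simp only [not_or] at hp hs0 hs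
  have hhi := hi_inlet_pos x
  have h0 : 0 < s := hs0.lt_of_ne' hp.1
  have htop : s < R.height ε x := hs.lt_of_ne hp.2.2
  have hrim : R.hi x < 1 := x.2.2.lt_of_ne fun h => hp.2.1 (by simp [height, h])
  simp only [inner, Set.mem_ofPred_eq, lo_rise, hi_rise]
  refine ⟨by linarith, ?_, ?_⟩
  · exact mul_lt_of_lt_one_right (by linarith) hrim
  · rw [mul_left_comm]
    refine mul_lt_of_lt_one_right (by linarith) ?_
    rw [← lt_div_iff₀ hhi, one_div]
    simp only [height] at htop
    linarith

theorem manifoldBoundary_subset_preimage {d : ℕ} {E : Type*} [TopologicalSpace E]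
    (L : V ≃ₜ EuclideanSpace ℝ (Fin d)) (φ : E ≃ₜ subgraph (R.height ε)) :
    manifoldBoundary d E ⊆ φ ⁻¹'
      {p | p.1.2 = 0 ∨ R.height ε p.1.1 = ε ∨ p.1.2 = R.height ε p.1.1} := by
  intro z hz
  by_contra hp
  have hinner := rise_mem_inner hp
  have hembed : Topology.IsOpenEmbedding (φ.symm ∘ lower (R := R) (ε := ε)) :=
    φ.symm.isOpenEmbedding.comp isOpenEmbedding_lower
  refine notMem_manifoldBoundary_of_isOpenEmbedding
    (L.isOpenEmbedding.comp isOpen_inner.isOpenEmbedding_subtypeVal) hembed ⟨_, hinner⟩ ?_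
  simpa only [Function.comp_apply, lower_rise, φ.symm_apply_apply] using hz

end Interior

section Frontier

variable {R}

theorem isClosed_cone : IsClosed R.cone :=
  (isClosed_le continuous_const R.continuous_lo).inter
    (isClosed_le R.continuous_hi continuous_const)

theorem interior_cone : interior R.cone = {v | 1 < R.lo v ∧ R.hi v < 1} := by
  refine subset_antisymm (fun v hv => ?_) (interior_maximal (fun v hv => ⟨hv.1.le, hv.2.le⟩)
    ((isOpen_lt continuous_const R.continuous_lo).inter
      (isOpen_lt R.continuous_hi continuous_const)))
  have hlo : 0 < R.lo v := one_pos.trans_le (interior_subset hv).1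
  have hhi : 0 < R.hi v := R.hi_pos v hlo
  have hray : ContinuousAt (fun t : ℝ => t • v) 1 := by fun_prop
  have hnear : ∀ᶠ t : ℝ in nhds 1, t • v ∈ R.cone ∧ 0 < t :=
    (hray.eventually_mem (by simpa using mem_interior_iff_mem_nhds.1 hv)).and (lt_mem_nhds one_pos)
  obtain ⟨t, ⟨ht, ht0⟩, ht1⟩ :=
    ((hnear.filter_mono nhdsWithin_le_nhds).and (self_mem_nhdsWithin (s := Set.Iio 1))).exists
  obtain ⟨s, ⟨hs, hs0⟩, hs1⟩ :=
    ((hnear.filter_mono nhdsWithin_le_nhds).and (self_mem_nhdsWithin (s := Set.Ioi 1))).exists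
  refine ⟨ht.1.trans_lt ?_, lt_of_lt_of_le ?_ hs.2⟩
  · rw [R.lo_smul _ _ ht0]
    exact mul_lt_of_lt_one_left hlo ht1
  · rw [R.hi_smul _ _ hs0]
    exact lt_mul_of_one_lt_left hhi hs1

theorem interior_cone_nonempty {u : V} (h0 : 0 < R.lo u) (hu : R.hi u < R.lo u) :
    (interior R.cone).Nonempty := by
  have hsum : 0 < R.lo u + R.hi u := add_pos h0 (R.hi_pos u h0)
  have hscale : 0 < 2 / (R.lo u + R.hi u) := div_pos two_pos hsum
  rw [interior_cone]
  refine ⟨(2 / (R.lo u + R.hi u)) • u, ?_, ?_⟩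
  · rw [R.lo_smul _ _ hscale, div_mul_eq_mul_div, one_lt_div hsum]
    linarith
  · rw [R.hi_smul _ _ hscale, div_mul_eq_mul_div, div_lt_one hsum]
    linarith

theorem frontier_cone : frontier R.cone = R.inlet ∪ R.outlet := by
  rw [isClosed_cone.frontier_eq, interior_cone]
  ext v
  simp only [cone, inlet, outlet, Set.mem_sdiff, Set.mem_union, Set.mem_ofPred_eq]
  grind

/-- The rays through `v + t • u`, `t > 0`, leave the truncated cone at points that lie outside
`inlet` and tend to `v`. -/
theorem mem_closure_outlet_sdiff_inlet (hlo : ∀ v w, R.lo v + R.lo w ≤ R.lo (v + w))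
    (hhi : ∀ v w, R.hi (v + w) ≤ R.hi v + R.hi w) {u : V} (hu : R.hi u < R.lo u) {v : V}
    (hv : R.lo v = 1) (hv' : R.hi v = 1) : v ∈ closure (R.outlet \ R.inlet) := by
  let p : ℝ → V := fun t => (R.hi (v + t • u))⁻¹ • (v + t • u)
  have hline : Continuous fun t : ℝ => v + t • u := by fun_prop
  have hhiline := (R.continuous_hi.comp hline).continuousAt (x := 0)
  have hp : ContinuousAt p 0 := (hhiline.inv₀ (by simp [hv'])).smul hline.continuousAt
  have hp0 : p 0 = v := by simp [p, hv']
  have hpos : ∀ᶠ t : ℝ in nhds 0, 0 < R.hi (v + t • u) :=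
    hhiline.eventually_const_lt (by simp [hv'])
  have hlt {t : ℝ} (ht : 0 < t) : R.hi (v + t • u) < R.lo (v + t • u) :=
    calc R.hi (v + t • u) ≤ 1 + t * R.hi u := by
          simpa only [R.hi_smul _ _ ht, hv'] using hhi v (t • u)
      _ < 1 + t * R.lo u := by gcongr
      _ ≤ R.lo (v + t • u) := by simpa only [R.lo_smul _ _ ht, hv] using hlo v (t • u)
  rw [← hp0]
  refine mem_closure_of_tendsto (hp.tendsto.mono_left (nhdsWithin_le_nhds (s := Set.Ioi 0))) ?_
  filter_upwards [nhdsWithin_le_nhds hpos, self_mem_nhdsWithin] with t hhi0 ht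
  have hlop : 1 < R.lo (p t) := by
    rw [R.lo_smul _ _ (inv_pos.2 hhi0), ← div_eq_inv_mul, one_lt_div hhi0]
    exact hlt ht
  have hhip : R.hi (p t) = 1 := by
    rw [R.hi_smul _ _ (inv_pos.2 hhi0), inv_mul_cancel₀ hhi0.ne']
  exact ⟨⟨hlop.le, hhip⟩, fun h => hlop.ne' h.1⟩

theorem interiorIn_inlet (hlo : ∀ v w, R.lo v + R.lo w ≤ R.lo (v + w))
    (hhi : ∀ v w, R.hi (v + w) ≤ R.hi v + R.hi w) {u : V} (hu : R.hi u < R.lo u) :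
    interiorIn (R.inlet ∪ R.outlet) R.inlet = {v | R.lo v = 1 ∧ R.hi v < 1} := by
  ext v
  rw [mem_interiorIn_iff]
  constructor
  · rintro ⟨hv, hn⟩
    have hve : v ∈ R.inlet := mem_of_mem_nhdsWithin hv hn
    refine ⟨hve.1, hve.2.lt_of_ne fun h1 => ?_⟩
    obtain ⟨w, hw, hwout, hwin⟩ := mem_closure_iff_nhds.1
      (mem_closure_outlet_sdiff_inlet hlo hhi hu hve.1 h1) _ (mem_nhdsWithin_iff_eventually.1 hn)
    exact hwin (hw (.inr hwout))
  · rintro ⟨h1, h2⟩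
    refine ⟨.inl ⟨h1, h2.le⟩, ?_⟩
    rw [mem_nhdsWithin_iff_eventually]
    filter_upwards [R.continuous_hi.continuousAt.eventually_lt_const h2] with w hw hwm
    exact hwm.resolve_right fun h => hw.ne h.2

theorem frontier_sdiff_interiorIn_inlet (hlo : ∀ v w, R.lo v + R.lo w ≤ R.lo (v + w))
    (hhi : ∀ v w, R.hi (v + w) ≤ R.hi v + R.hi w) {u : V} (hu : R.hi u < R.lo u) :
    frontier R.cone \ interiorIn (frontier R.cone) R.inlet = R.outlet := by
  rw [frontier_cone, interiorIn_inlet hlo hhi hu]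
  ext v
  simp only [inlet, outlet, Set.mem_sdiff, Set.mem_union, Set.mem_ofPred_eq]
  grind

end Frontier

end RadialPair

/-- The conclusion of the theorem for a subset `B` of a normed space, with tab `G × [0, ε]`:
`B ∪ G × [0, ε]` has a stretching of the tab that retracts `B` onto the closure of the part of its
boundary outside `G` and fixes the boundary of the `d`-manifold `B ∪ G × [0, ε]`. -/
def HasExtensionStretching {X : Type*} [NormedAddCommGroup X] [NormedSpace ℝ X] (d : ℕ)
    (B G : Set X) (ε : ℝ) : Prop :=
  HasTabStretching (E := tabExtension B G ε)
    {z | z.1 ∈ B ×ˢ ({0} : Set ℝ)}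
    {z | z.1 ∈ (intrinsicFrontier ℝ B \ interiorIn (intrinsicFrontier ℝ B) G) ×ˢ ({0} : Set ℝ)}
    {z | z.1 ∈ G ×ˢ Set.Icc 0 ε}
    (manifoldBoundary d (tabExtension B G ε))

namespace RadialPair

variable {V X : Type*} [NormedAddCommGroup V] [NormedSpace ℝ V] [NormedAddCommGroup X]
  [NormedSpace ℝ X] {R : RadialPair V}

theorem hasExtensionStretching [FiniteDimensional ℝ V] (ι : V →ᵃⁱ[ℝ] X)
    (hlo : ∀ v w, R.lo v + R.lo w ≤ R.lo (v + w)) (hhi : ∀ v w, R.hi (v + w) ≤ R.hi v + R.hi w)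
    {u : V} (hu0 : 0 < R.lo u) (hu : R.hi u < R.lo u) {d : ℕ} (hd : Module.finrank ℝ V = d)
    {ε : ℝ} (hε : 0 < ε) : HasExtensionStretching d (ι '' R.cone) (ι '' R.inlet) ε := by
  have hι : Topology.IsEmbedding ι := ι.isometry.isEmbedding
  have hunglued : intrinsicFrontier ℝ (ι '' R.cone) \
      interiorIn (intrinsicFrontier ℝ (ι '' R.cone)) (ι '' R.inlet) = ι '' R.outlet := by
    rw [AffineIsometry.intrinsicFrontier_image,
      intrinsicFrontier_eq_frontier (interior_cone_nonempty hu0 hu), interiorIn_image hι,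
      ← Set.image_sdiff hι.injective, frontier_sdiff_interiorIn_inlet hlo hhi hu]
  let lift : tabExtension R.cone R.inlet ε ≃ₜ tabExtension (ι '' R.cone) (ι '' R.inlet) ε :=
    ((hι.prodMap .id).homeomorphImage _).trans (.setCongr (image_tabExtension ι _ _ ε))
  let φ := lift.symm.trans (straightenHomeomorph hε.le)
  have hlift (z : tabExtension (ι '' R.cone) (ι '' R.inlet) ε) (S : Set V) (J : Set ℝ) :
      z.1 ∈ (ι '' S) ×ˢ J ↔ (lift.symm z).1 ∈ S ×ˢ J := by
    obtain ⟨z, rfl⟩ := lift.surjective z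
    rw [lift.symm_apply_apply]
    change (ι z.1.1, z.1.2) ∈ (ι '' S) ×ˢ J ↔ _
    rw [Set.mem_prod, Set.mem_prod, hι.injective.mem_set_image]
  have L : V ≃ₜ EuclideanSpace ℝ (Fin d) := (ContinuousLinearEquiv.ofFinrankEq
    (hd.trans finrank_euclideanSpace_fin.symm)).toHomeomorph
  have main := ((subgraph.hasTabStretching hε le_height
    (continuous_height (R := R))).preimage φ).mono_fixed
      (manifoldBoundary_subset_preimage L φ)
  unfold HasExtensionStretching
  convert main using 1
  all_goals ext z
  · exact (hlift z _ _).trans (le_straighten_snd_iff hε.le _).symm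
  · rw [hunglued]
    exact (hlift z _ _).trans (straighten_snd_eq_height_iff hε.le _).symm
  · exact (hlift z _ _).trans (straighten_snd_le_iff hε.le _).symm

end RadialPair

section Prism

/-- The vectors of `ℝ^ι` with coordinate sum zero, the directions of the standard simplex. -/
def sumZero (ι : Type*) [Fintype ι] : Submodule ℝ (ι → ℝ) :=
  LinearMap.ker (∑ i, LinearMap.proj i : (ι → ℝ) →ₗ[ℝ] ℝ)

theorem mem_sumZero {ι : Type*} [Fintype ι] {w : ι → ℝ} : w ∈ sumZero ι ↔ ∑ i, w i = 0 := by
  simp [sumZero]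

theorem finrank_sumZero_add_one (ι : Type*) [Fintype ι] [Nonempty ι] :
    Module.finrank ℝ (sumZero ι) + 1 = Fintype.card ι := by
  classical
  have hsurj : LinearMap.range (∑ i, LinearMap.proj i : (ι → ℝ) →ₗ[ℝ] ℝ) = ⊤ := by
    refine LinearMap.range_eq_top.2 fun c => ?_
    exact ⟨Pi.single (Classical.arbitrary ι) c, by simp⟩
  rw [sumZero, ← Module.finrank_fintype_fun_eq_card ℝ, ← LinearMap.finrank_range_add_finrank_ker
    (∑ i, LinearMap.proj i : (ι → ℝ) →ₗ[ℝ] ℝ), hsurj, finrank_top, Module.finrank_self, add_comm]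

/-- The smallest of the coordinates with index in `J` (`0` if `J` is empty). -/
noncomputable def minCoord {ι : Type*} (J : Set ι) (x : ι → ℝ) : ℝ := ⨅ i : J, x i

section MinCoord

variable {ι : Type*} {J : Set ι}

theorem minCoord_smul {t : ℝ} (ht : 0 ≤ t) (x : ι → ℝ) : minCoord J (t • x) = t * minCoord J x :=
  (Real.mul_iInf_of_nonneg ht _).symm

variable [Finite ι]

theorem le_minCoord_iff (hJ : J.Nonempty) {a : ℝ} {x : ι → ℝ} :
    a ≤ minCoord J x ↔ ∀ i ∈ J, a ≤ x i :=
  have := hJ.to_subtype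
  (le_ciInf_iff (Set.finite_range _).bddBelow).trans Subtype.forall

theorem exists_eq_minCoord (hJ : J.Nonempty) (x : ι → ℝ) : ∃ i ∈ J, x i = minCoord J x :=
  have := hJ.to_subtype
  let ⟨i, hi⟩ := exists_eq_ciInf_of_finite (f := fun i : J => x i)
  ⟨i, i.2, hi⟩

theorem minCoord_add_le (hJ : J.Nonempty) (x y : ι → ℝ) :
    minCoord J x + minCoord J y ≤ minCoord J (x + y) :=
  (le_minCoord_iff hJ).2 fun i hi =>
    add_le_add ((le_minCoord_iff hJ).1 le_rfl i hi) ((le_minCoord_iff hJ).1 le_rfl i hi)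

theorem continuous_minCoord (hJ : J.Nonempty) : Continuous (minCoord J) := by
  have := hJ.to_subtype
  have := Fintype.ofFinite J
  change Continuous fun x : ι → ℝ => ⨅ i : J, x i
  simp only [← Finset.inf'_univ_eq_ciInf]
  exact Continuous.finset_inf'_apply _ fun i _ => continuous_apply _

end MinCoord

/-- A point of the hyperplane of the standard simplex that lies beyond the facets opposite to the
vertices in `J` and beyond no other facet. -/
noncomputable def viewPoint {ι : Type*} (J : Set ι) (i : ι) : ℝ :=
  J.indicator (fun _ => -1) i + Jᶜ.indicator (fun _ => (1 + J.ncard : ℝ) / Jᶜ.ncard) i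

section ViewPoint

variable {ι : Type*} {J : Set ι}

theorem viewPoint_of_mem {i : ι} (hi : i ∈ J) : viewPoint J i = -1 := by simp [viewPoint, hi]

theorem viewPoint_pos [Finite ι] {i : ι} (hi : i ∉ J) : 0 < viewPoint J i := by
  have hcard : 0 < Jᶜ.ncard := (Set.ncard_pos (Set.toFinite _)).2 ⟨i, hi⟩
  rw [viewPoint, Set.indicator_of_notMem hi, zero_add, Set.indicator_of_mem (Set.mem_compl hi)]
  positivity

theorem sum_viewPoint [Fintype ι] (hJ : Jᶜ.Nonempty) : ∑ i, viewPoint J i = 1 := by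
  classical
  have hcard : 0 < Jᶜ.ncard := (Set.ncard_pos (Set.toFinite _)).2 hJ
  have hsum (A : Set ι) (c : ℝ) : ∑ i, A.indicator (fun _ => c) i = A.ncard * c := by
    simp [Set.indicator_apply, ← Finset.sum_filter, Set.ncard_eq_toFinset_card']
  simp only [viewPoint, Finset.sum_add_distrib, hsum]
  field_simp
  ring

end ViewPoint

variable {F : Type*} [NormedAddCommGroup F] [NormedSpace ℝ F] {K : Set F} {ι : Type*} [Fintype ι]
  {J : Set ι} {q : F}

variable (K ι) in
/-- The directions of the prism `K × Δ^ι`. -/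
abbrev PrismDirection : Type _ := vectorSpan ℝ K × sumZero ι

variable (K J q) in
/-- The parametrisation of the affine span of the prism based at `(q, viewPoint J)`. -/
noncomputable def prismChart : PrismDirection K ι →ᵃⁱ[ℝ] F × (ι → ℝ) :=
  (AffineIsometryEquiv.constVAdd ℝ (F × (ι → ℝ)) (q, viewPoint J)).toAffineIsometry.comp
    (LinearIsometry.toAffineIsometry
      ⟨(vectorSpan ℝ K).subtype.prodMap (sumZero ι).subtype, fun _ => rfl⟩)

theorem prismChart_apply (v : PrismDirection K ι) :
    prismChart K J q v = (q + v.1, viewPoint J + v.2) := rfl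

theorem mem_range_prismChart (hJ : Jᶜ.Nonempty) (hq : q ∈ K) {x : F × (ι → ℝ)} (hxK : x.1 ∈ K)
    (hx : ∑ i, x.2 i = 1) : x ∈ Set.range (prismChart K J q) := by
  refine ⟨(⟨x.1 - q, vsub_mem_vectorSpan ℝ hxK hq⟩, ⟨x.2 - viewPoint J, mem_sumZero.2 ?_⟩), ?_⟩
  · simp [Finset.sum_sub_distrib, hx, sum_viewPoint hJ]
  · simp [prismChart_apply]

variable (K J q) in
/-- The part of the affine span of the prism `K × Δ^ι` that is cut out by `K` and the facets of the
simplex not visible from `viewPoint J`, in the coordinates of `prismChart`. -/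
def hiddenSet : Set (PrismDirection K ι) :=
  prismChart K J q ⁻¹' (K ×ˢ Set.pi Jᶜ fun _ => Set.Ici 0)

theorem convex_hiddenSet (hK : Convex ℝ K) : Convex ℝ (hiddenSet K J q) :=
  (hK.prod (convex_pi fun _ _ => convex_Ici 0)).affine_preimage (prismChart K J q).toAffineMap

theorem isClosed_hiddenSet (hK : IsClosed K) : IsClosed (hiddenSet K J q) :=
  (hK.prod (isClosed_set_pi fun _ _ => isClosed_Ici)).preimage (prismChart K J q).continuous

theorem eventually_add_mem_of_mem_intrinsicInterior (hq : q ∈ intrinsicInterior ℝ K) :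
    ∀ᶠ w : vectorSpan ℝ K in nhds 0, q + w ∈ K := by
  obtain ⟨y, hy, rfl⟩ := mem_intrinsicInterior.1 hq
  let translate (w : vectorSpan ℝ K) : affineSpan ℝ K :=
    ⟨w +ᵥ (y : F), AffineSubspace.vadd_mem_of_mem_direction
      (by rw [direction_affineSpan]; exact w.2) y.2⟩
  have hcont : Continuous translate := by
    exact (continuous_subtype_val.add continuous_const).subtype_mk _
  have h0 : translate 0 = y := by ext; simp [translate]
  have hmem := hcont.continuousAt.eventually_mem (x := 0)
    (by rw [h0]; exact mem_interior_iff_mem_nhds.1 hy)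
  filter_upwards [hmem] with w hw
  rw [add_comm]
  exact hw

theorem hiddenSet_mem_nhds (hq : q ∈ intrinsicInterior ℝ K) : hiddenSet K J q ∈ nhds 0 := by
  have hfst : ∀ᶠ v : PrismDirection K ι in nhds 0, q + v.1 ∈ K :=
    continuous_fst.tendsto' 0 0 rfl |>.eventually (eventually_add_mem_of_mem_intrinsicInterior hq)
  have hsnd : ∀ᶠ v : PrismDirection K ι in nhds 0, ∀ i, i ∉ J → 0 < viewPoint J i + v.2.1 i := by
    refine Filter.eventually_all.2 fun i => Filter.eventually_imp_distrib_left.2 fun hi => ?_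
    have hcont : Continuous fun v : PrismDirection K ι => viewPoint J i + v.2.1 i :=
      continuous_const.add ((continuous_apply i).comp continuous_snd.subtype_val)
    exact hcont.continuousAt.eventually_const_lt (by simpa using viewPoint_pos hi)
  filter_upwards [hfst, hsnd] with v hv hv'
  exact ⟨hv, fun i hi => (hv' i hi).le⟩

/-- The coordinates of `v` sum to zero, so one of those outside `J` decreases along the ray through
`v`, which therefore leaves the hidden set. -/
theorem gauge_hiddenSet_pos (hJ : J.Nonempty)
    (hgauge : ∀ v, gauge (hiddenSet K J q) v ≤ 1 → v ∈ hiddenSet K J q)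
    {v : PrismDirection K ι} (hv : 0 < minCoord J v.2) : 0 < gauge (hiddenSet K J q) v := by
  obtain ⟨j, hj⟩ := hJ
  have hpos {i : ι} (hi : i ∈ J) : 0 < v.2.1 i :=
    hv.trans_le ((le_minCoord_iff ⟨j, hj⟩).1 le_rfl i hi)
  obtain ⟨i, hi⟩ : ∃ i, v.2.1 i < 0 := by
    by_contra! hnonneg
    exact (Finset.sum_pos' (fun i _ => hnonneg i) ⟨j, Finset.mem_univ _, hpos hj⟩).ne'
      (mem_sumZero.1 v.2.2)
  have hiJ : i ∉ J := fun h => (hpos h).not_gt hi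
  have hview : 0 < viewPoint J i + 1 := add_pos (viewPoint_pos hiJ) one_pos
  refine (gauge_nonneg _).lt_of_ne' fun h0 => ?_
  let t := (viewPoint J i + 1) / -v.2.1 i
  have ht : 0 ≤ t := (div_pos hview (neg_pos.2 hi)).le
  have hmem : t • v ∈ hiddenSet K J q :=
    hgauge _ (by rw [gauge_smul_of_nonneg ht, h0, smul_zero]; exact zero_le_one)
  have hcoord : 0 ≤ viewPoint J i + t * v.2.1 i := hmem.2 i hiJ
  have htv : t * v.2.1 i = -(viewPoint J i + 1) := by
    simp only [t, div_neg, neg_mul, div_mul_cancel₀ _ hi.ne]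
  linarith

theorem gauge_hiddenSet_le_one_iff (hK : Convex ℝ K) (hKc : IsClosed K)
    (hq : q ∈ intrinsicInterior ℝ K) (v : PrismDirection K ι) :
    gauge (hiddenSet K J q) v ≤ 1 ↔ v ∈ hiddenSet K J q := by
  rw [gauge_le_one_iff_mem_closure (convex_hiddenSet hK) (hiddenSet_mem_nhds hq),
    (isClosed_hiddenSet hKc).closure_eq]

/-- The pair of functions on `PrismDirection K ι` whose truncated cone is the prism: `lo` accounts
for the facets opposite to the vertices in `J` and `hi` for all the others. -/
noncomputable def prismPair (hK : Convex ℝ K) (hKc : IsClosed K) (hJ : J.Nonempty)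
    (hq : q ∈ intrinsicInterior ℝ K) : RadialPair (PrismDirection K ι) where
  lo v := minCoord J v.2
  hi := gauge (hiddenSet K J q)
  continuous_lo := (continuous_minCoord hJ).comp continuous_snd.subtype_val
  continuous_hi := continuous_gauge (convex_hiddenSet hK) (hiddenSet_mem_nhds hq)
  lo_smul _ v ht := minCoord_smul ht.le v.2.1
  hi_smul t v ht := by rw [gauge_smul_of_nonneg ht.le, smul_eq_mul]
  hi_pos _ := gauge_hiddenSet_pos hJ fun v => (gauge_hiddenSet_le_one_iff hK hKc hq v).1

section PrismPair

variable (hK : Convex ℝ K) (hKc : IsClosed K) (hJ : J.Nonempty) (hq : q ∈ intrinsicInterior ℝ K)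

theorem prismChart_mem_prism_iff (hJc : Jᶜ.Nonempty) (v : PrismDirection K ι) :
    prismChart K J q v ∈ K ×ˢ stdSimplex ℝ ι ↔ v ∈ (prismPair hK hKc hJ hq).cone := by
  have hlo : 1 ≤ minCoord J v.2 ↔ ∀ i ∈ J, 0 ≤ viewPoint J i + v.2.1 i := by
    rw [le_minCoord_iff hJ]
    refine forall₂_congr fun i hi => ?_
    rw [viewPoint_of_mem hi, neg_add_eq_sub, sub_nonneg]
  have hsum : ∑ i, (viewPoint J i + v.2.1 i) = 1 := by
    rw [Finset.sum_add_distrib, sum_viewPoint hJc, mem_sumZero.1 v.2.2, add_zero]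
  change _ ↔ 1 ≤ minCoord J v.2 ∧ gauge (hiddenSet K J q) v ≤ 1
  rw [hlo, gauge_hiddenSet_le_one_iff hK hKc hq]
  constructor
  · exact fun ⟨hvK, hv, _⟩ => ⟨fun i _ => hv i, hvK, fun i _ => hv i⟩
  · rintro ⟨hvJ, hvK, hv⟩
    exact ⟨hvK, fun i => (em (i ∈ J)).elim (hvJ i) (hv i), hsum⟩

theorem prismChart_mem_facets_iff (hJc : Jᶜ.Nonempty) (v : PrismDirection K ι) :
    prismChart K J q v ∈ K ×ˢ ⋃ i ∈ J, {x ∈ stdSimplex ℝ ι | x i = 0} ↔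
      v ∈ (prismPair hK hKc hJ hq).inlet := by
  have hfacets : prismChart K J q v ∈ K ×ˢ ⋃ i ∈ J, {x ∈ stdSimplex ℝ ι | x i = 0} ↔
      prismChart K J q v ∈ K ×ˢ stdSimplex ℝ ι ∧ ∃ i ∈ J, v.2.1 i = 1 := by
    have hcoord {i : ι} (hi : i ∈ J) : (prismChart K J q v).2 i = 0 ↔ v.2.1 i = 1 := by
      change viewPoint J i + v.2.1 i = 0 ↔ _
      rw [viewPoint_of_mem hi, neg_add_eq_zero, eq_comm]
    simp only [Set.mem_prod, Set.mem_iUnion, Set.mem_ofPred_eq, exists_prop]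
    grind
  rw [hfacets, prismChart_mem_prism_iff hK hKc hJ hq hJc]
  constructor
  · rintro ⟨⟨hlo, hhi⟩, i, hi, hone⟩
    exact ⟨le_antisymm (((le_minCoord_iff hJ).1 le_rfl i hi).trans_eq hone) hlo, hhi⟩
  · rintro ⟨hlo, hhi⟩
    obtain ⟨i, hi, hmin⟩ := exists_eq_minCoord hJ v.2.1
    exact ⟨⟨hlo.ge, hhi⟩, i, hi, hmin.trans hlo⟩

theorem image_cone_prismPair (hJc : Jᶜ.Nonempty) :
    prismChart K J q '' (prismPair hK hKc hJ hq).cone = K ×ˢ stdSimplex ℝ ι := by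
  refine subset_antisymm ?_ fun x hx => ?_
  · rintro _ ⟨v, hv, rfl⟩
    exact (prismChart_mem_prism_iff hK hKc hJ hq hJc v).2 hv
  · obtain ⟨v, rfl⟩ := mem_range_prismChart hJc (intrinsicInterior_subset hq) hx.1 hx.2.2
    exact ⟨v, (prismChart_mem_prism_iff hK hKc hJ hq hJc v).1 hx, rfl⟩

theorem image_inlet_prismPair (hJc : Jᶜ.Nonempty) :
    prismChart K J q '' (prismPair hK hKc hJ hq).inlet =
      K ×ˢ ⋃ i ∈ J, {x ∈ stdSimplex ℝ ι | x i = 0} := by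
  refine subset_antisymm ?_ fun x hx => ?_
  · rintro _ ⟨v, hv, rfl⟩
    exact (prismChart_mem_facets_iff hK hKc hJ hq hJc v).2 hv
  · obtain ⟨i, -, hsimplex, -⟩ := Set.mem_iUnion₂.1 hx.2
    obtain ⟨v, rfl⟩ := mem_range_prismChart hJc (intrinsicInterior_subset hq) hx.1 hsimplex.2
    exact ⟨v, (prismChart_mem_facets_iff hK hKc hJ hq hJc v).1 hx, rfl⟩

/-- The witness is the direction from `viewPoint J` to the barycentre of the simplex. -/
theorem exists_prismPair_hi_lt_lo (hJc : Jᶜ.Nonempty) :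
    ∃ u, 0 < (prismPair hK hKc hJ hq).lo u ∧
      (prismPair hK hKc hJ hq).hi u < (prismPair hK hKc hJ hq).lo u := by
  have hne : Nonempty ι := ⟨hJ.some⟩
  have hcard : (0 : ℝ) < Fintype.card ι := Nat.cast_pos.2 Fintype.card_pos
  obtain ⟨u, hu⟩ := mem_range_prismChart hJc (intrinsicInterior_subset hq)
    (x := (q, fun _ => (Fintype.card ι : ℝ)⁻¹)) (intrinsicInterior_subset hq)
    (by simp [hcard.ne'])
  have hcoord (i : ι) : viewPoint J i + u.2.1 i = (Fintype.card ι : ℝ)⁻¹ :=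
    congrFun (congrArg Prod.snd hu) i
  have hhi : gauge (hiddenSet K J q) u ≤ 1 := by
    rw [gauge_hiddenSet_le_one_iff hK hKc hq, hiddenSet, Set.mem_preimage, hu]
    exact ⟨intrinsicInterior_subset hq, fun i _ => (inv_pos.2 hcard).le⟩
  have hlo : 1 < minCoord J u.2 := by
    obtain ⟨i, hi, hmin⟩ := exists_eq_minCoord hJ u.2.1
    linarith [hcoord i, viewPoint_of_mem hi, inv_pos.2 hcard]
  exact ⟨u, one_pos.trans hlo, hhi.trans_lt hlo⟩

end PrismPair

end Prism

section Permutohedron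

theorem isClosed_permutohedron (n : ℕ) : IsClosed (permutohedron n) :=
  (Set.finite_range _).isClosed_convexHull ℝ

theorem convex_permutohedron (n : ℕ) : Convex ℝ (permutohedron n) := convex_convexHull ℝ _

theorem permutohedron_nonempty (n : ℕ) : (permutohedron n).Nonempty :=
  (Set.range_nonempty permVertex).convexHull

theorem permVertex_one_sub_permVertex_swap {n : ℕ} (i j : Fin n) :
    permVertex 1 - permVertex (Equiv.swap i j) =
      ((i : ℝ) - j) • (Pi.single i 1 - Pi.single j 1) := by
  funext l
  simp only [permVertex, Pi.sub_apply, Pi.smul_apply, smul_eq_mul, Equiv.swap_inv, inv_one,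
    Equiv.Perm.one_apply, Equiv.swap_apply_def, Pi.single_apply]
  split_ifs <;> simp_all

theorem single_sub_single_mem_vectorSpan_permutohedron {n : ℕ} (i j : Fin n) :
    (Pi.single i 1 - Pi.single j 1 : Fin n → ℝ) ∈ vectorSpan ℝ (permutohedron n) := by
  rcases eq_or_ne i j with rfl | hij
  · simp
  have hne : (i : ℝ) - j ≠ 0 := sub_ne_zero.2 (by simpa [Fin.val_inj] using hij)
  rw [← Submodule.smul_mem_iff _ hne, ← permVertex_one_sub_permVertex_swap]
  exact vsub_mem_vectorSpan ℝ (subset_convexHull ℝ _ (Set.mem_range_self _))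
    (subset_convexHull ℝ _ (Set.mem_range_self _))

theorem vectorSpan_permutohedron (n : ℕ) : vectorSpan ℝ (permutohedron n) = sumZero (Fin n) := by
  apply le_antisymm
  · rw [← direction_affineSpan, permutohedron, affineSpan_convexHull, direction_affineSpan,
      vectorSpan_def, Submodule.span_le]
    rintro _ ⟨_, ⟨σ, rfl⟩, _, ⟨τ, rfl⟩, rfl⟩
    have hsum (ρ : Equiv.Perm (Fin n)) : ∑ i, permVertex ρ i = ∑ i : Fin n, ((i : ℕ) + 1 : ℝ) :=
      Equiv.sum_comp ρ⁻¹ fun i : Fin n => ((i : ℕ) + 1 : ℝ)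
    simp [mem_sumZero, hsum]
  · intro w hw
    rcases isEmpty_or_nonempty (Fin n) with hn | ⟨⟨j⟩⟩
    · rw [Subsingleton.elim w 0]
      exact zero_mem _
    have hw' : w = ∑ i, w i • (Pi.single i 1 - Pi.single j 1 : Fin n → ℝ) := by
      simp_rw [smul_sub]
      rw [Finset.sum_sub_distrib, ← Finset.sum_smul, mem_sumZero.1 hw, zero_smul, sub_zero]
      exact pi_eq_sum_univ' w
    rw [hw']
    exact Submodule.sum_mem _ fun i _ =>
      Submodule.smul_mem _ _ (single_sub_single_mem_vectorSpan_permutohedron i j)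

theorem vectorSpan_pi {R κ : Type*} [Ring R] [Finite κ] {V : κ → Type*}
    [∀ i, AddCommGroup (V i)] [∀ i, Module R (V i)] {s : ∀ i, Set (V i)}
    (hs : ∀ i, (s i).Nonempty) :
    vectorSpan R (Set.univ.pi s) = Submodule.pi Set.univ fun i => vectorSpan R (s i) := by
  classical
  choose p hp using hs
  apply le_antisymm
  · rw [vectorSpan_def, Submodule.span_le]
    rintro _ ⟨x, hx, y, hy, rfl⟩ i hi
    exact vsub_mem_vectorSpan R (hx i hi) (hy i hi)
  · rw [← Submodule.iSup_map_single, iSup_le_iff]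
    intro i
    rw [vectorSpan_def, Submodule.map_span, Submodule.span_le]
    rintro _ ⟨_, ⟨x, hx, y, hy, rfl⟩, rfl⟩
    have hupdate {z : V i} (hz : z ∈ s i) : Function.update p i z ∈ Set.univ.pi s :=
      (Set.update_mem_pi_iff_of_mem fun j _ => hp j).2 fun _ => hz
    have hdiff : Pi.single i (x - y) = Function.update p i x - Function.update p i y := by
      rw [← Function.update_sub, sub_self, Pi.single]
    change Pi.single i (x - y) ∈ _
    rw [hdiff]
    exact vsub_mem_vectorSpan R (hupdate hx) (hupdate hy)

theorem finrank_pi_univ {R κ : Type*} [Ring R] [StrongRankCondition R] [Fintype κ]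
    {V : κ → Type*} [∀ i, AddCommGroup (V i)] [∀ i, Module R (V i)] (p : ∀ i, Submodule R (V i))
    [∀ i, Module.Free R (p i)] [∀ i, Module.Finite R (p i)] :
    Module.finrank R (Submodule.pi Set.univ p) = ∑ i, Module.finrank R (p i) := by
  let coordinates : Submodule.pi Set.univ p ≃ₗ[R] ∀ i, p i :=
    { toFun := fun x i => ⟨x.1 i, x.2 i trivial⟩
      invFun := fun y => ⟨fun i => y i, fun i _ => (y i).2⟩
      map_add' := fun _ _ => rfl
      map_smul' := fun _ _ => rfl }
  rw [coordinates.finrank_eq, Module.finrank_pi_fintype]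

section PermProduct

variable {k : ℕ} (m : Fin k → ℕ)

theorem isClosed_permProduct : IsClosed (permProduct m) :=
  isClosed_set_pi fun i _ => isClosed_permutohedron (m i)

theorem convex_permProduct : Convex ℝ (permProduct m) :=
  convex_pi fun i _ => convex_permutohedron (m i)

theorem permProduct_nonempty : (permProduct m).Nonempty :=
  Set.univ_pi_nonempty_iff.2 fun i => permutohedron_nonempty (m i)

variable {m} in
theorem finrank_vectorSpan_permProduct_add (hm : ∀ i, 1 ≤ m i) :
    Module.finrank ℝ (vectorSpan ℝ (permProduct m)) + k = ∑ i, m i := by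
  have hfactor (i : Fin k) : Module.finrank ℝ (vectorSpan ℝ (permutohedron (m i))) + 1 = m i := by
    have : Nonempty (Fin (m i)) := ⟨⟨0, hm i⟩⟩
    rw [vectorSpan_permutohedron, finrank_sumZero_add_one, Fintype.card_fin]
  rw [permProduct, vectorSpan_pi fun i => permutohedron_nonempty (m i), finrank_pi_univ]
  simp_rw [← Finset.sum_congr rfl fun i _ => hfactor i, Finset.sum_add_distrib]
  simp

end PermProduct

end Permutohedron

theorem mainTheorem8_general {F : Type*} [NormedAddCommGroup F] [NormedSpace ℝ F]
    [FiniteDimensional ℝ F] {K : Set F} (hK : Convex ℝ K) (hKc : IsClosed K) (hKne : K.Nonempty)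
    {ι : Type*} [Fintype ι] {J : Set ι} (hJ : J.Nonempty) (hJc : Jᶜ.Nonempty) {d : ℕ}
    (hd : Module.finrank ℝ (vectorSpan ℝ K) + Fintype.card ι = d + 1) {ε : ℝ} (hε : 0 < ε) :
    HasExtensionStretching d (K ×ˢ stdSimplex ℝ ι)
      (K ×ˢ ⋃ i ∈ J, {x ∈ stdSimplex ℝ ι | x i = 0}) ε := by
  have : Nonempty ι := ⟨hJ.some⟩
  obtain ⟨q, hq⟩ := hKne.intrinsicInterior hK
  obtain ⟨u, hu0, hu⟩ := exists_prismPair_hi_lt_lo hK hKc hJ hq hJc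
  have hfinrank : Module.finrank ℝ (PrismDirection K ι) = d := by
    have := finrank_sumZero_add_one ι
    rw [Module.finrank_prod]
    lia
  rw [← image_cone_prismPair hK hKc hJ hq hJc, ← image_inlet_prismPair hK hKc hJ hq hJc]
  exact RadialPair.hasExtensionStretching (prismChart K J q)
    (fun v w => minCoord_add_le hJ v.2.1 w.2.1)
    (gauge_add_le (convex_hiddenSet hK) (absorbent_nhds_zero (hiddenSet_mem_nhds hq)))
    hu0 hu hfinrank hε

theorem mainTheorem8 {k : ℕ} (hk : 2 ≤ k) (m : Fin k → ℕ) (hm : ∀ i, 1 ≤ m i)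
    (ε : ℝ) (hε : 0 < ε) :
    ∃ (f : C(extCell m ε, extCell m ε))
      (H : ContinuousMap.Homotopy (ContinuousMap.id (extCell m ε)) f),
      -- `H` deformation retracts the basic cell, inside itself, onto its unglued boundary part
      ((∀ t : unitInterval, ∀ x ∈ basicInExt m ε, H (t, x) ∈ basicInExt m ε) ∧
        (fun x => H (1, x)) '' basicInExt m ε = ungluedInExt m ε ∧
        (∀ t : unitInterval, ∀ x ∈ ungluedInExt m ε, H (t, x) = x)) ∧
      -- the end of `H` maps the tab homeomorphically onto the extended cell
      (∃ e : tabInExt m ε ≃ₜ extCell m ε, ∀ x : tabInExt m ε, e x = H (1, (x : extCell m ε))) ∧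
      -- `H` is the identity homotopy on the boundary of the extended cell
      (∀ t : unitInterval, ∀ x ∈ manifoldBoundary (∑ i, m i) (extCell m ε), H (t, x) = x) := by
  have hmiddle : {i : Fin (k + 1) | i ≠ 0 ∧ i ≠ Fin.last k}.Nonempty :=
    ⟨⟨1, by lia⟩, Fin.ne_of_val_ne one_ne_zero, Fin.ne_of_val_ne (by rw [Fin.val_last]; lia)⟩
  have hdim : Module.finrank ℝ (vectorSpan ℝ (permProduct m)) + Fintype.card (Fin (k + 1)) =
      ∑ i, m i + 1 := by
    rw [Fintype.card_fin, ← add_assoc, finrank_vectorSpan_permProduct_add hm]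
  exact mainTheorem8_general (convex_permProduct m) (isClosed_permProduct m)
    (permProduct_nonempty m) hmiddle ⟨0, fun h => h.1 rfl⟩ hdim hε
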